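/- Let Thompson's group $F$ be the group of all strictly increasing piecewise linear homeomorphisms of $[0,1]$ with finitely many breakpoints, all at dyadic rational numbers, and with all slopes integer powers of $2$. Let $x_0,x_1\in F$ be the standard generators $$x_0(t)=\begin{cases}\frac t2,&0\le t\le\frac12,\\ t-\frac14,&\frac12\le t\le\frac34,\\ 2t-1,&\frac34\le t\le1,\end{cases}\qquad x_1(t)=\begin{cases}t,&0\le t\le\frac12,\\ \frac t2+\frac14,&\frac12\le t\le\frac34,\\ t-\frac18,&\frac34\le t\le\frac78,\\ 2t-1,&\frac78\le t\le1.\end{cases}$$ For $x\in(0,1)$ the marked Schreier graph $\Gamma_x$ is the oriented labelled graph whose vertices are the points of the $F$-orbit of $x$, with an arrow labelled $i\in\{0,1\}$ from $u$ to $v$ if and only if $x_i(u)=v$. The pointed marked Schreier graph of $x$ is $\Gamma_x$ with base vertex $x$. Isomorphisms of marked graphs preserve the orientations and the labels of arrows; isomorphisms of pointed marked graphs moreover preserve the base vertex. Then: 1. If $x,y\in(0,1)$ and $x\ne y$, then the pointed marked Schreier graphs of $x$ and $y$ are not isomorphic. 2. For all $x,y\in(0,1)$ the following conditions are equivalent: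 (a) $\Gamma_x$ and $\Gamma_y$ are isomorphic as marked graphs (without base vertex); (b) $x$ and $y$ belong to the same $F$-orbit; (c) $x$ and $y$ have binary expansions with the same tails, that is, there are binary expansions $x=0.a_1a_2a_3\ldots$ and $y=0.b_1b_2b_3\ldots$ and integers $m,n\ge0$ such that $a_{m+k}=b_{n+k}$ for all $k\ge1$. -/

import Mathlib

noncomputable section

namespace ThompsonSchreier

open unitInterval

/-- A real number is dyadic (rational) if it has the form `m / 2 ^ k`. -/
def IsDyadic (x : ℝ) : Prop := ∃ (m : ℤ) (k : ℕ), x = m / 2 ^ k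

/-- `B` is a set of breakpoints for `f`: on each interval `[a, b]` whose interior contains no
point of `B`, the function `f` is affine, and its slope is an integer power of `2`. -/
def IsBreakSet (B : Finset I) (f : I → I) : Prop :=
  ∀ a b : I, (∀ d ∈ B, d ∉ Set.Ioo a b) →
    ∃ (n : ℤ) (c : ℝ), ∀ t ∈ Set.Icc a b, (f t : ℝ) = (2 : ℝ) ^ n * (t : ℝ) + c

/-- The defining property of elements of Thompson's group: `f` is strictly increasing and
piecewise linear, with finitely many breakpoints, all of them dyadic rationals, and with slopes
that are integer powers of `2`. -/
def IsThompson (f : I ≃ₜ I) : Prop :=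
  StrictMono f ∧ ∃ B : Finset I, (∀ d ∈ B, IsDyadic (d : ℝ)) ∧ IsBreakSet B f

theorem IsDyadic.add {x y : ℝ} (hx : IsDyadic x) (hy : IsDyadic y) : IsDyadic (x + y) := by
  obtain ⟨m, k, rfl⟩ := hx
  obtain ⟨n, l, rfl⟩ := hy
  refine ⟨m * 2 ^ l + n * 2 ^ k, k + l, ?_⟩
  push_cast
  rw [pow_add]
  field_simp

theorem IsDyadic.neg {x : ℝ} (hx : IsDyadic x) : IsDyadic (-x) := by
  obtain ⟨m, k, rfl⟩ := hx
  exact ⟨-m, k, by push_cast; ring⟩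

theorem IsDyadic.sub {x y : ℝ} (hx : IsDyadic x) (hy : IsDyadic y) : IsDyadic (x - y) := by
  rw [sub_eq_add_neg]; exact hx.add hy.neg

theorem IsDyadic.zpow_mul {x : ℝ} (hx : IsDyadic x) (n : ℤ) : IsDyadic ((2 : ℝ) ^ n * x) := by
  obtain ⟨m, k, rfl⟩ := hx
  obtain ⟨l, rfl | rfl⟩ := n.eq_nat_or_neg
  · exact ⟨2 ^ l * m, k, by push_cast; rw [zpow_natCast]; ring⟩
  · refine ⟨m, l + k, ?_⟩
    rw [zpow_neg, zpow_natCast, pow_add]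
    field_simp

theorem isDyadic_zero : IsDyadic 0 := ⟨0, 0, by simp⟩

theorem strictMono_zero {f : I ≃ₜ I} (hf : StrictMono f) : f 0 = 0 := by
  obtain ⟨t, ht⟩ := f.surjective 0
  have : f 0 ≤ f t := hf.monotone unitInterval.nonneg'
  rw [ht] at this
  exact le_antisymm this unitInterval.nonneg'

/-- Below each point `t` lies a dyadic point `b` with a dyadic image such that `f` is affine on
`[b, t]`. -/
theorem exists_dyadic_below {f : I ≃ₜ I} (hf : StrictMono f) {B : Finset I}
    (hB : ∀ d ∈ B, IsDyadic (d : ℝ)) (hBf : IsBreakSet B f) (N : ℕ) :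
    ∀ t : I, (B.filter (· < t)).card ≤ N →
    ∃ b : I, b ≤ t ∧ IsDyadic (b : ℝ) ∧ IsDyadic (f b : ℝ) ∧
      ∃ n : ℤ, (f t : ℝ) = f b + (2 : ℝ) ^ n * ((t : ℝ) - b) := by
  induction N with
  | zero =>
    intro t ht
    have h0 : B.filter (· < t) = ∅ := Finset.card_eq_zero.mp (Nat.le_zero.mp ht)
    have h1 : (0 : I) ≤ t := unitInterval.nonneg'
    obtain ⟨n, c, h⟩ := hBf 0 t (fun d hd hd' => by
      have : d ∈ B.filter (· < t) := Finset.mem_filter.mpr ⟨hd, hd'.2⟩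
      simp [h0] at this)
    refine ⟨0, h1, by simpa using isDyadic_zero, ?_, n, ?_⟩
    · rw [strictMono_zero hf]; simpa using isDyadic_zero
    · rw [h t ⟨h1, le_rfl⟩, h 0 ⟨le_rfl, h1⟩]; ring
  | succ N ih =>
    intro t ht
    by_cases h0 : (B.filter (· < t)).Nonempty
    · obtain ⟨hbB, hbt⟩ := Finset.mem_filter.mp (Finset.max'_mem _ h0)
      set b := (B.filter (· < t)).max' h0 with hb
      have hcard : (B.filter (· < b)).card ≤ N := by
        have : (B.filter (· < b)).card < (B.filter (· < t)).card := by
          apply Finset.card_lt_card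
          rw [Finset.ssubset_iff_of_subset]
          · exact ⟨b, Finset.mem_filter.mpr ⟨hbB, hbt⟩, by simp⟩
          · intro d hd
            simp only [Finset.mem_filter] at hd ⊢
            exact ⟨hd.1, hd.2.trans hbt⟩
        omega
      obtain ⟨a, -, ha, hfa, m, hm⟩ := ih b hcard
      obtain ⟨n, c, h⟩ := hBf b t (fun d hd hd' => by
        have : d ≤ b := Finset.le_max' _ d (Finset.mem_filter.mpr ⟨hd, hd'.2⟩)
        exact absurd hd'.1 (not_lt.mpr this))
      refine ⟨b, hbt.le, hB b hbB, ?_, n, ?_⟩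
      · rw [hm]; exact hfa.add (((hB b hbB).sub ha).zpow_mul m)
      · rw [h t ⟨hbt.le, le_rfl⟩, h b ⟨le_rfl, hbt.le⟩]; ring
    · exact ih t (by rw [Finset.not_nonempty_iff_eq_empty.mp h0]; simp)

theorem IsThompson.isDyadic_iff {f : I ≃ₜ I} (hf : IsThompson f) (t : I) :
    IsDyadic (f t : ℝ) ↔ IsDyadic (t : ℝ) := by
  obtain ⟨hm, B, hB, hBf⟩ := hf
  obtain ⟨b, -, hb, hfb, n, hn⟩ := exists_dyadic_below hm hB hBf _ t le_rfl
  constructor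
  · intro h
    have : (t : ℝ) = b + (2 : ℝ) ^ (-n) * ((f t : ℝ) - f b) := by
      rw [hn, zpow_neg]
      have : (2 : ℝ) ^ n ≠ 0 := by positivity
      field_simp
      ring
    rw [this]
    exact hb.add ((h.sub hfb).zpow_mul _)
  · intro h
    rw [hn]
    exact hfb.add ((h.sub hb).zpow_mul n)

theorem isThompson_one : IsThompson 1 :=
  ⟨fun _ _ h => h, ∅, by simp, fun _ _ _ => ⟨0, 0, fun t _ => by simp⟩⟩

theorem strictMono_inv {f : I ≃ₜ I} (hf : StrictMono f) : StrictMono (f⁻¹ : I ≃ₜ I) := by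
  intro a b hab
  have h : ∀ c, f (f⁻¹ c) = c := fun c => f.apply_symm_apply c
  rw [← hf.lt_iff_lt, h, h]
  exact hab

theorem IsThompson.inv {f : I ≃ₜ I} (hf : IsThompson f) : IsThompson f⁻¹ := by
  have hiff := hf.isDyadic_iff
  obtain ⟨hm, B, hB, hBf⟩ := hf
  have hr : ∀ c, f (f⁻¹ c) = c := fun c => f.apply_symm_apply c
  have hl : ∀ c, f⁻¹ (f c) = c := fun c => f.symm_apply_apply c
  have hm' := strictMono_inv hm
  refine ⟨hm', B.image f, ?_, ?_⟩
  · intro d hd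
    obtain ⟨e, he, rfl⟩ := Finset.mem_image.mp hd
    exact (hiff e).mpr (hB e he)
  · intro a b hab
    obtain ⟨n, c, h⟩ := hBf (f⁻¹ a) (f⁻¹ b) (fun d hd hd' => by
      refine hab (f d) (Finset.mem_image_of_mem f hd) ⟨?_, ?_⟩
      · have := hm hd'.1; rwa [hr] at this
      · have := hm hd'.2; rwa [hr] at this)
    refine ⟨-n, -((2 : ℝ) ^ (-n) * c), fun t ht => ?_⟩
    have := h (f⁻¹ t) ⟨hm'.monotone ht.1, hm'.monotone ht.2⟩
    rw [hr] at this
    rw [this, zpow_neg]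
    have : (2 : ℝ) ^ n ≠ 0 := by positivity
    field_simp
    ring

theorem IsThompson.mul {f g : I ≃ₜ I} (hf : IsThompson f) (hg : IsThompson g) :
    IsThompson (f * g) := by
  have hiff := hg.isDyadic_iff
  obtain ⟨hm, B, hB, hBf⟩ := hf
  obtain ⟨km, C, hC, hCg⟩ := hg
  have hr : ∀ c, g (g⁻¹ c) = c := fun c => g.apply_symm_apply c
  have hl : ∀ c, g⁻¹ (g c) = c := fun c => g.symm_apply_apply c
  refine ⟨hm.comp km, C ∪ B.image (g⁻¹ : I ≃ₜ I), ?_, ?_⟩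
  · intro d hd
    rcases Finset.mem_union.mp hd with hd | hd
    · exact hC d hd
    · obtain ⟨e, he, rfl⟩ := Finset.mem_image.mp hd
      rw [← hiff, hr]
      exact hB e he
  · intro a b hab
    obtain ⟨n, c, h⟩ := hCg a b (fun d hd => hab d (Finset.mem_union_left _ hd))
    obtain ⟨m, e, k⟩ := hBf (g a) (g b) (fun d hd hd' => by
      refine hab (g⁻¹ d) (Finset.mem_union_right _ (Finset.mem_image_of_mem _ hd)) ⟨?_, ?_⟩
      · rw [← km.lt_iff_lt, hr]; exact hd'.1
      · rw [← km.lt_iff_lt, hr]; exact hd'.2)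
    refine ⟨m + n, (2 : ℝ) ^ m * c + e, fun t ht => ?_⟩
    have h1 := k (g t) ⟨km.monotone ht.1, km.monotone ht.2⟩
    rw [h t ht] at h1
    change (f (g t) : ℝ) = _
    rw [h1, zpow_add₀ two_ne_zero]
    ring

/-- Thompson's group `F`, as a subgroup of the group of all homeomorphisms of `[0, 1]`;
the product `f * g` is the map `t ↦ f (g t)`. -/
def F : Subgroup (I ≃ₜ I) where
  carrier := {f | IsThompson f}
  mul_mem' := IsThompson.mul
  one_mem' := isThompson_one
  inv_mem' := IsThompson.inv

/-- The standard action of `F` on `[0, 1]` by evaluation. -/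
instance : MulAction F I where
  smul f t := (f : I ≃ₜ I) t
  one_smul _ := rfl
  mul_smul _ _ _ := rfl

/-- A strictly increasing surjection of `[0, 1]` as a homeomorphism. -/
def homeoOfStrictMono (f : I → I) (hf : StrictMono f) (hs : Function.Surjective f) : I ≃ₜ I :=
  (hf.orderIsoOfSurjective f hs).toHomeomorph

theorem homeoOfStrictMono_apply (f : I → I) (hf : StrictMono f) (hs : Function.Surjective f)
    (t : I) : homeoOfStrictMono f hf hs t = f t := rfl

/-- The formula for the generator `x₀`. -/
def x₀Fun (t : ℝ) : ℝ :=
  if t ≤ 1 / 2 then t / 2 else if t ≤ 3 / 4 then t - 1 / 4 else 2 * t - 1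

/-- The formula for the generator `x₁`. -/
def x₁Fun (t : ℝ) : ℝ :=
  if t ≤ 1 / 2 then t else if t ≤ 3 / 4 then t / 2 + 1 / 4
  else if t ≤ 7 / 8 then t - 1 / 8 else 2 * t - 1

theorem x₀Fun_mem (t : I) : x₀Fun t ∈ I := by
  obtain ⟨t, h0, h1⟩ := t
  simp only [x₀Fun]
  constructor <;> split_ifs <;> linarith

theorem x₁Fun_mem (t : I) : x₁Fun t ∈ I := by
  obtain ⟨t, h0, h1⟩ := t
  simp only [x₁Fun]
  constructor <;> split_ifs <;> linarith

theorem x₀Fun_strictMono : StrictMono (fun t : I => (⟨x₀Fun t, x₀Fun_mem t⟩ : I)) := by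
  rintro ⟨s, hs⟩ ⟨t, ht⟩ (h : s < t)
  change x₀Fun s < x₀Fun t
  simp only [x₀Fun]
  split_ifs <;> linarith

theorem x₁Fun_strictMono : StrictMono (fun t : I => (⟨x₁Fun t, x₁Fun_mem t⟩ : I)) := by
  rintro ⟨s, hs⟩ ⟨t, ht⟩ (h : s < t)
  change x₁Fun s < x₁Fun t
  simp only [x₁Fun]
  split_ifs <;> linarith

theorem x₀Fun_surjective :
    Function.Surjective (fun t : I => (⟨x₀Fun t, x₀Fun_mem t⟩ : I)) := by
  rintro ⟨s, h0, h1⟩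
  rcases le_or_gt s (1 / 4) with h | h
  · refine ⟨⟨2 * s, by linarith, by linarith⟩, Subtype.ext ?_⟩
    simp only [x₀Fun]; split_ifs <;> linarith
  rcases le_or_gt s (1 / 2) with h' | h'
  · refine ⟨⟨s + 1 / 4, by linarith, by linarith⟩, Subtype.ext ?_⟩
    simp only [x₀Fun]; split_ifs <;> linarith
  · refine ⟨⟨(s + 1) / 2, by linarith, by linarith⟩, Subtype.ext ?_⟩
    simp only [x₀Fun]; split_ifs <;> linarith

theorem x₁Fun_surjective :
    Function.Surjective (fun t : I => (⟨x₁Fun t, x₁Fun_mem t⟩ : I)) := by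
  rintro ⟨s, h0, h1⟩
  rcases le_or_gt s (1 / 2) with h | h
  · refine ⟨⟨s, by linarith, by linarith⟩, Subtype.ext ?_⟩
    simp only [x₁Fun]; rw [if_pos h]
  rcases le_or_gt s (5 / 8) with h' | h'
  · refine ⟨⟨2 * s - 1 / 2, by linarith, by linarith⟩, Subtype.ext ?_⟩
    simp only [x₁Fun]; split_ifs <;> linarith
  rcases le_or_gt s (3 / 4) with h'' | h''
  · refine ⟨⟨s + 1 / 8, by linarith, by linarith⟩, Subtype.ext ?_⟩
    simp only [x₁Fun]; split_ifs <;> linarith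
  · refine ⟨⟨(s + 1) / 2, by linarith, by linarith⟩, Subtype.ext ?_⟩
    simp only [x₁Fun]; split_ifs <;> linarith

theorem isThompson_x₀ :
    IsThompson (homeoOfStrictMono _ x₀Fun_strictMono x₀Fun_surjective) := by
  refine ⟨x₀Fun_strictMono, {⟨1 / 2, by norm_num, by norm_num⟩, ⟨3 / 4, by norm_num, by norm_num⟩},
    ?_, ?_⟩
  · intro d hd
    simp only [Finset.mem_insert, Finset.mem_singleton] at hd
    rcases hd with rfl | rfl
    · exact ⟨1, 1, by norm_num⟩
    · exact ⟨3, 2, by norm_num⟩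
  · rintro ⟨a, ha⟩ ⟨b, hb⟩ h
    simp only [Finset.mem_insert, Finset.mem_singleton, forall_eq_or_imp, forall_eq, Set.mem_Ioo,
      not_and, not_lt, ← Subtype.coe_lt_coe, ← Subtype.coe_le_coe] at h
    simp only [homeoOfStrictMono_apply, Subtype.forall, Set.mem_Icc, Subtype.mk_le_mk]
    rcases le_or_gt b (1 / 2) with h1 | h1
    · refine ⟨-1, 0, fun t _ ht => ?_⟩
      simp only [x₀Fun]; rw [if_pos (by linarith)]; norm_num; ring
    have h1' : 1 / 2 ≤ a := by
      by_contra hc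
      linarith [h.1 (not_le.mp hc)]
    rcases le_or_gt b (3 / 4) with h2 | h2
    · refine ⟨0, -(1 / 4), fun t _ ht => ?_⟩
      simp only [x₀Fun, zpow_zero]; split_ifs <;> linarith
    have h2' : 3 / 4 ≤ a := by
      by_contra hc
      linarith [h.2 (not_le.mp hc)]
    refine ⟨1, -1, fun t _ ht => ?_⟩
    simp only [x₀Fun, zpow_one]; split_ifs <;> linarith

theorem isThompson_x₁ :
    IsThompson (homeoOfStrictMono _ x₁Fun_strictMono x₁Fun_surjective) := by
  refine ⟨x₁Fun_strictMono, {⟨1 / 2, by norm_num, by norm_num⟩, ⟨3 / 4, by norm_num, by norm_num⟩,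
    ⟨7 / 8, by norm_num, by norm_num⟩}, ?_, ?_⟩
  · intro d hd
    simp only [Finset.mem_insert, Finset.mem_singleton] at hd
    rcases hd with rfl | rfl | rfl
    · exact ⟨1, 1, by norm_num⟩
    · exact ⟨3, 2, by norm_num⟩
    · exact ⟨7, 3, by norm_num⟩
  · rintro ⟨a, ha⟩ ⟨b, hb⟩ h
    simp only [Finset.mem_insert, Finset.mem_singleton, forall_eq_or_imp, forall_eq, Set.mem_Ioo,
      not_and, not_lt, ← Subtype.coe_lt_coe, ← Subtype.coe_le_coe] at h
    simp only [homeoOfStrictMono_apply, Subtype.forall, Set.mem_Icc, Subtype.mk_le_mk]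
    rcases le_or_gt b (1 / 2) with h1 | h1
    · refine ⟨0, 0, fun t _ ht => ?_⟩
      simp only [x₁Fun, zpow_zero]; rw [if_pos (by linarith)]; ring
    have h1' : 1 / 2 ≤ a := by
      by_contra hc
      linarith [h.1 (not_le.mp hc)]
    rcases le_or_gt b (3 / 4) with h2 | h2
    · refine ⟨-1, 1 / 4, fun t _ ht => ?_⟩
      have e : (2 : ℝ) ^ (-1 : ℤ) = 1 / 2 := by norm_num
      simp only [x₁Fun, e]; split_ifs <;> linarith
    have h2' : 3 / 4 ≤ a := by
      by_contra hc
      linarith [h.2.1 (not_le.mp hc)]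
    rcases le_or_gt b (7 / 8) with h3 | h3
    · refine ⟨0, -(1 / 8), fun t _ ht => ?_⟩
      simp only [x₁Fun, zpow_zero]; split_ifs <;> linarith
    have h3' : 7 / 8 ≤ a := by
      by_contra hc
      linarith [h.2.2 (not_le.mp hc)]
    refine ⟨1, -1, fun t _ ht => ?_⟩
    simp only [x₁Fun, zpow_one]; split_ifs <;> linarith

/-- The generator `x₀` of `F`. -/
def x₀ : F := ⟨_, isThompson_x₀⟩

/-- The generator `x₁` of `F`. -/
def x₁ : F := ⟨_, isThompson_x₁⟩

/-- The standard generating family `(x₀, x₁)`, indexed by the labels `0` and `1`. -/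
def gen : Fin 2 → F := ![x₀, x₁]

/-- The (unpointed) marked Schreier graph of the point `x`: its vertices are the points of the
`F`-orbit of `x`, and there is an arrow labelled `i` from `u` to `v` iff `gen i • u = v`. -/
abbrev Schreier (x : I) : Type := Quiver.SchreierGraph (MulAction.orbit F x) gen

/-- The base vertex of the pointed Schreier graph of `x`. -/
def base (x : I) : Schreier x := ⟨⟨x, MulAction.mem_orbit_self x⟩⟩

/-- The label of an arrow of the Schreier graph of `x`. -/
def label {x : I} {u v : Schreier x} (a : u ⟶ v) : Fin 2 :=
  (Quiver.SchreierGraph.labelling (MulAction.orbit F x) gen).map a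

/-- Isomorphisms of (unpointed) marked Schreier graphs: bijections of vertices and of arrows
that preserve sources, targets and labels of arrows. -/
structure MarkedIso (x y : I) where
  onVertices : Schreier x ≃ Schreier y
  onArrows : ∀ u v : Schreier x, (u ⟶ v) ≃ (onVertices u ⟶ onVertices v)
  label_onArrows : ∀ (u v : Schreier x) (a : u ⟶ v), label (onArrows u v a) = label a

/-- The pointed marked Schreier graphs of `x` and `y` are isomorphic. -/
def PointedIsomorphic (x y : I) : Prop :=
  ∃ φ : MarkedIso x y, φ.onVertices (base x) = base y

/-- The unpointed marked Schreier graphs of `x` and `y` are isomorphic. -/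
def Isomorphic (x y : I) : Prop := Nonempty (MarkedIso x y)

/-- `x` and `y` have binary expansions with the same tails: some binary expansion of `x` and some
binary expansion of `y` agree after deletion of finite, possibly different, numbers of initial
digits. -/
def SameTails (x y : I) : Prop :=
  ∃ a b : ℕ → Fin 2, Real.ofDigits a = (x : ℝ) ∧ Real.ofDigits b = (y : ℝ) ∧
    ∃ m n : ℕ, ∀ k : ℕ, a (m + k) = b (n + k)

end ThompsonSchreier

end

noncomputable section

namespace ThompsonSchreier

open unitInterval

/-! A marked isomorphism commutes with the subgroup generated by `x₀` and `x₁`, so it preserves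
stabilizers in that subgroup. These stabilizers separate points of the open interval
(`exists_genClosure_fix_move`), so every isomorphism is the identity on points
(`MarkedIso.point_onVertices`). This gives part 1 and (a) ⇒ (b); for (b) ⇒ (a) the identity of the
common orbit serves. For (c) ⇒ (b), `exists_genClosure_affine` expands a small dyadic interval
around each point to `[1/2, 3/4]`, so the image depends only on a tail of digits. For (b) ⇒ (c), an
element of `F` is locally `t ↦ 2 ^ n * t + d` with `d` dyadic, which only shifts far-out digits.
That `x₀` and `x₁` generate `F` is never needed. -/

theorem coe_x₀_smul (t : I) : ((x₀ • t : I) : ℝ) = x₀Fun t := rfl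

theorem coe_x₁_smul (t : I) : ((x₁ • t : I) : ℝ) = x₁Fun t := rfl

theorem coe_x₀_smul_of_ge {t : I} (ht : 3 / 4 ≤ (t : ℝ)) : ((x₀ • t : I) : ℝ) = 2 * t - 1 := by
  rw [coe_x₀_smul, x₀Fun]
  split_ifs <;> linarith

theorem coe_x₀_inv_smul_of_le {t : I} (ht : (t : ℝ) ≤ 1 / 4) :
    ((x₀⁻¹ • t : I) : ℝ) = 2 * t := by
  have h := coe_x₀_smul (x₀⁻¹ • t)
  rw [smul_inv_smul, x₀Fun] at h
  split_ifs at h <;> linarith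

theorem coe_x₀_inv_smul_of_mem {t : I} (ht : 1 / 4 ≤ (t : ℝ)) (ht' : (t : ℝ) ≤ 1 / 2) :
    ((x₀⁻¹ • t : I) : ℝ) = t + 1 / 4 := by
  have h := coe_x₀_smul (x₀⁻¹ • t)
  rw [smul_inv_smul, x₀Fun] at h
  split_ifs at h <;> linarith

theorem coe_x₁_inv_smul_of_mem {t : I} (ht : 1 / 2 ≤ (t : ℝ)) (ht' : (t : ℝ) ≤ 5 / 8) :
    ((x₁⁻¹ • t : I) : ℝ) = 2 * t - 1 / 2 := by
  have h := coe_x₁_smul (x₁⁻¹ • t)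
  rw [smul_inv_smul, x₁Fun] at h
  split_ifs at h <;> linarith

theorem coe_x₁_inv_smul_of_mem' {t : I} (ht : 5 / 8 ≤ (t : ℝ)) (ht' : (t : ℝ) ≤ 3 / 4) :
    ((x₁⁻¹ • t : I) : ℝ) = t + 1 / 8 := by
  have h := coe_x₁_smul (x₁⁻¹ • t)
  rw [smul_inv_smul, x₁Fun] at h
  split_ifs at h <;> linarith

theorem x₁_smul_of_le {t : I} (ht : (t : ℝ) ≤ 1 / 2) : x₁ • t = t := by
  apply Subtype.ext
  rw [coe_x₁_smul, x₁Fun, if_pos ht]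

theorem x₁_smul_ne {t : I} (ht : 1 / 2 < (t : ℝ)) (ht' : (t : ℝ) < 1) : x₁ • t ≠ t := by
  intro h
  have h' := coe_x₁_smul t
  rw [h, x₁Fun] at h'
  split_ifs at h' <;> linarith

theorem smul_strictMono (g : F) : StrictMono (fun t : I => g • t) := g.2.1

theorem smul_zero_eq (g : F) : g • (0 : I) = 0 := strictMono_zero g.2.1

theorem smul_one_eq (g : F) : g • (1 : I) = 1 := by
  refine le_antisymm unitInterval.le_one' ?_
  have h := (smul_strictMono g).monotone (unitInterval.le_one' (t := g⁻¹ • 1))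
  simpa using h

theorem smul_mem_Ioo (g : F) {t : I} (ht : t ∈ Set.Ioo (0 : I) 1) :
    g • t ∈ Set.Ioo (0 : I) 1 := by
  have h0 := smul_strictMono g ht.1
  have h1 := smul_strictMono g ht.2
  simp only [smul_zero_eq, smul_one_eq] at h0 h1
  exact ⟨h0, h1⟩

/-! ### Expanding dyadic intervals and separating points by generators -/

/-- The subgroup of `F` generated by `x₀` and `x₁`. -/
def genClosure : Subgroup F := Subgroup.closure (Set.range gen)

theorem x₀_mem_genClosure : x₀ ∈ genClosure := Subgroup.subset_closure ⟨0, rfl⟩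

theorem x₁_mem_genClosure : x₁ ∈ genClosure := Subgroup.subset_closure ⟨1, rfl⟩

/-- Every standard dyadic interval in the interior of `[0, 1]` is mapped affinely onto
`[1/2, 3/4]` by a product of generators and their inverses. -/
theorem exists_genClosure_affine (m : ℕ) : ∀ A : ℕ, 0 < A → A + 1 < 2 ^ (m + 2) →
    ∃ h ∈ genClosure, ∀ t : I, ∀ s ∈ Set.Icc (0 : ℝ) 1, (t : ℝ) * 2 ^ (m + 2) = A + s →
      ((h • t : I) : ℝ) = 1 / 2 + s / 4 := by
  induction m with
  | zero =>
    intro A hA hA'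
    obtain rfl | rfl : A = 1 ∨ A = 2 := by norm_num at hA'; omega
    · refine ⟨x₀⁻¹, inv_mem x₀_mem_genClosure, fun t s hs ht => ?_⟩
      obtain ⟨h0, h1⟩ := hs
      norm_num at ht
      rw [coe_x₀_inv_smul_of_mem] <;> linarith
    · refine ⟨1, one_mem _, fun t s hs ht => ?_⟩
      norm_num at ht
      rw [one_smul]
      linarith
  | succ m ih =>
    -- In units of `Q = 2 ^ m` all the bounds on `A` are linear, hence within reach of `omega`.
    obtain ⟨Q, hQ⟩ : ∃ Q : ℕ, Q = 2 ^ m := ⟨_, rfl⟩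
    have hQ0 : 0 < Q := hQ ▸ by positivity
    have hQr : (2 : ℝ) ^ m = Q := by rw [hQ]; norm_cast
    have hQR : (0 : ℝ) < Q := by exact_mod_cast hQ0
    have e : 2 ^ (m + 2) = 4 * Q := by rw [hQ]; ring
    have e' : 2 ^ (m + 1 + 2) = 8 * Q := by rw [hQ]; ring
    have er : (2 : ℝ) ^ (m + 2) = 4 * Q := by rw [← hQr]; ring
    have er' : (2 : ℝ) ^ (m + 1 + 2) = 8 * Q := by rw [← hQr]; ring
    rw [e] at ih
    rw [e']
    simp only [er, er'] at ih ⊢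
    have lo : ∀ {t s c : ℝ} {A k : ℕ}, 0 ≤ s → t * (8 * Q) = A + s → k * Q ≤ A →
        c * 8 = k → c ≤ t := by
      intro t s c A k hs ht hA hc
      have hA' : (k : ℝ) * Q ≤ A := by exact_mod_cast hA
      have : c * (8 * Q) ≤ t * (8 * Q) := by rw [ht, ← mul_assoc, hc]; linarith
      exact le_of_mul_le_mul_right this (by positivity)
    have hi : ∀ {t s c : ℝ} {A k : ℕ}, s ≤ 1 → t * (8 * Q) = A + s → A + 1 ≤ k * Q →
        c * 8 = k → t ≤ c := by
      intro t s c A k hs ht hA hc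
      have hA' : (A : ℝ) + 1 ≤ k * Q := by exact_mod_cast hA
      have : t * (8 * Q) ≤ c * (8 * Q) := by rw [ht, ← mul_assoc, hc]; linarith
      exact le_of_mul_le_mul_right this (by positivity)
    -- The right half comes first, since the second quarter is translated into it at the same level.
    -- Each case here uses a word of slope 2, which lowers the level by one.
    have right : ∀ A : ℕ, 4 * Q ≤ A → A + 1 < 8 * Q →
        ∃ h ∈ genClosure, ∀ t : I, ∀ s ∈ Set.Icc (0 : ℝ) 1, (t : ℝ) * (8 * Q) = A + s →
          ((h • t : I) : ℝ) = 1 / 2 + s / 4 := by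
      intro A hA hA'
      rcases lt_or_ge A (5 * Q) with h5 | h5
      · obtain ⟨B, rfl⟩ : ∃ B, A = B + 2 * Q := ⟨A - 2 * Q, by omega⟩
        obtain ⟨h, hh, H⟩ := ih B (by omega) (by omega)
        refine ⟨h * x₁⁻¹, mul_mem hh (inv_mem x₁_mem_genClosure), fun t s hs ht => ?_⟩
        rw [mul_smul]
        refine H _ s hs ?_
        rw [coe_x₁_inv_smul_of_mem (lo hs.1 ht hA (by norm_num))
          (hi hs.2 ht (show _ ≤ 5 * Q by omega) (by norm_num))]
        push_cast at ht
        linear_combination ht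
      rcases lt_or_ge A (6 * Q) with h6 | h6
      · obtain ⟨B, rfl⟩ : ∃ B, A = B + 3 * Q := ⟨A - 3 * Q, by omega⟩
        obtain ⟨h, hh, H⟩ := ih B (by omega) (by omega)
        refine ⟨h * x₀ * x₁⁻¹, mul_mem (mul_mem hh x₀_mem_genClosure)
          (inv_mem x₁_mem_genClosure), fun t s hs ht => ?_⟩
        rw [mul_smul, mul_smul]
        refine H _ s hs ?_
        have l : 5 / 8 ≤ (t : ℝ) := lo hs.1 ht h5 (by norm_num)
        have e1 := coe_x₁_inv_smul_of_mem' l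
          (hi hs.2 ht (show _ ≤ 6 * Q by omega) (by norm_num))
        rw [coe_x₀_smul_of_ge (by rw [e1]; linarith), e1]
        push_cast at ht
        linear_combination ht
      · obtain ⟨B, rfl⟩ : ∃ B, A = B + 4 * Q := ⟨A - 4 * Q, by omega⟩
        obtain ⟨h, hh, H⟩ := ih B (by omega) (by omega)
        refine ⟨h * x₀, mul_mem hh x₀_mem_genClosure, fun t s hs ht => ?_⟩
        rw [mul_smul]
        refine H _ s hs ?_
        rw [coe_x₀_smul_of_ge (lo hs.1 ht h6 (by norm_num))]
        push_cast at ht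
        linear_combination ht
    intro A hA hA'
    rcases lt_or_ge A (2 * Q) with h2 | h2
    · obtain ⟨h, hh, H⟩ := ih A hA (by omega)
      refine ⟨h * x₀⁻¹, mul_mem hh (inv_mem x₀_mem_genClosure), fun t s hs ht => ?_⟩
      rw [mul_smul]
      refine H _ s hs ?_
      rw [coe_x₀_inv_smul_of_le (hi hs.2 ht (show _ ≤ 2 * Q by omega) (by norm_num))]
      linear_combination ht
    rcases lt_or_ge A (4 * Q) with h4 | h4
    · obtain ⟨h, hh, H⟩ := right (A + 2 * Q) (by omega) (by omega)
      refine ⟨h * x₀⁻¹, mul_mem hh (inv_mem x₀_mem_genClosure), fun t s hs ht => ?_⟩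
      rw [mul_smul]
      refine H _ s hs ?_
      rw [coe_x₀_inv_smul_of_mem (lo hs.1 ht h2 (by norm_num))
        (hi hs.2 ht (show _ ≤ 4 * Q by omega) (by norm_num))]
      push_cast
      linear_combination ht
    · exact right A h4 hA'

/-- The subgroup generated by `x₀` and `x₁` contains, for any two points of the open interval, an
element that fixes the smaller one and moves the larger one. -/
theorem exists_genClosure_fix_move {x y : I} (hy : y < 1) (hxy : x < y) :
    ∃ g ∈ genClosure, g • x = x ∧ g • y ≠ y := by
  have hx0 : (0 : ℝ) ≤ x := x.2.1
  have hy1 : (y : ℝ) < 1 := hy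
  have hxy' : (x : ℝ) < y := hxy
  -- A gap of more than two grid steps leaves room for `A / P` strictly between `x` and `y`, with `A
  -- + 1 < P`.
  obtain ⟨m, hm⟩ := pow_unbounded_of_one_lt (2 / ((y : ℝ) - x)) (one_lt_two (α := ℝ))
  have hp : (2 : ℝ) ^ m ≤ 2 ^ (m + 2) := pow_le_pow_right₀ one_le_two (by omega)
  obtain ⟨P, hP⟩ : ∃ P : ℝ, P = 2 ^ (m + 2) := ⟨_, rfl⟩
  have hP0 : 0 < P := hP ▸ by positivity
  have hm' : 2 < P * (y - x) := by
    rw [div_lt_iff₀ (by linarith)] at hm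
    have := mul_le_mul_of_nonneg_right hp (by linarith : (0 : ℝ) ≤ y - x)
    rw [hP]
    linarith
  have f1 := Nat.floor_le (mul_nonneg hP0.le hx0)
  have f2 := Nat.lt_floor_add_one (P * (x : ℝ))
  have hPy : P * y < P := by nlinarith
  obtain ⟨A, hA⟩ : ∃ A : ℕ, A = ⌊P * (x : ℝ)⌋₊ + 1 := ⟨_, rfl⟩
  have hAr : (A : ℝ) = ⌊P * (x : ℝ)⌋₊ + 1 := by rw [hA]; push_cast; ring
  obtain ⟨h, hh, H⟩ := exists_genClosure_affine m A (by omega) (by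
    have : (A : ℝ) + 1 < 2 ^ (m + 2) := by rw [← hP]; linarith
    exact_mod_cast this)
  have hdx : (x : ℝ) < A / P := by rw [lt_div_iff₀ hP0]; linarith
  have hdy : A / P < (y : ℝ) := by rw [div_lt_iff₀ hP0]; linarith
  have hd : h • (⟨A / P, by linarith, by linarith⟩ : I) = ⟨1 / 2, by norm_num, by norm_num⟩ := by
    apply Subtype.ext
    rw [H _ 0 ⟨le_rfl, zero_le_one⟩ (by rw [← hP]; field_simp; ring)]
    norm_num
  have h1 : ((h • x : I) : ℝ) < 1 / 2 := by
    have := smul_strictMono h (show x < ⟨A / P, by linarith, by linarith⟩ from hdx)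
    simp only [hd] at this
    exact this
  have h2 : 1 / 2 < ((h • y : I) : ℝ) := by
    have := smul_strictMono h (show (⟨A / P, by linarith, by linarith⟩ : I) < y from hdy)
    simp only [hd] at this
    exact this
  have h3 : ((h • y : I) : ℝ) < 1 := by
    have := smul_strictMono h hy
    simp only [smul_one_eq] at this
    exact this
  -- `h` sends `A / P` to `1/2`, and `x₁` fixes everything up to `1/2` but no point of `(1/2, 1)`.
  refine ⟨h⁻¹ * x₁ * h, mul_mem (mul_mem (inv_mem hh) x₁_mem_genClosure) hh, ?_, ?_⟩
  · rw [mul_smul, mul_smul, x₁_smul_of_le h1.le, inv_smul_smul]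
  · rw [mul_smul, mul_smul, Ne, inv_smul_eq_iff]
    exact x₁_smul_ne h2 h3

/-! ### Rigidity of marked isomorphisms -/

/-- The source and label of an arrow determine its target. -/
theorem MarkedIso.onVertices_gen_smul {x y : I} (φ : MarkedIso x y) (i : Fin 2) (u : Schreier x) :
    φ.onVertices (gen i • u) = gen i • φ.onVertices u := by
  let a : u ⟶ gen i • u := ⟨i, rfl⟩
  have h1 : gen (label (φ.onArrows u _ a)) • φ.onVertices u = φ.onVertices (gen i • u) :=
    (φ.onArrows u _ a).2
  rw [φ.label_onArrows] at h1
  exact h1.symm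

theorem MarkedIso.onVertices_smul {x y : I} (φ : MarkedIso x y) {g : F} (hg : g ∈ genClosure) :
    ∀ u : Schreier x, φ.onVertices (g • u) = g • φ.onVertices u := by
  induction hg using Subgroup.closure_induction with
  | mem g hg =>
    obtain ⟨i, rfl⟩ := hg
    exact φ.onVertices_gen_smul i
  | one => simp
  | mul g h _ _ ihg ihh => intro u; rw [mul_smul, mul_smul, ihg, ihh]
  | inv g _ ih => intro u; rw [eq_inv_smul_iff, ← ih, smul_inv_smul]

/-- The point of `[0, 1]` underlying a vertex of a Schreier graph. -/
def point {x : I} (u : Schreier x) : I := u.toVertex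

theorem point_smul {x : I} (g : F) (u : Schreier x) : point (g • u) = g • point u := rfl

theorem point_injective {x : I} : Function.Injective (point (x := x)) := fun _ _ h =>
  Quiver.SchreierGraph.ext (Subtype.ext h)

theorem point_mem_Ioo {x : I} (hx : x ∈ Set.Ioo (0 : I) 1) (u : Schreier x) :
    point u ∈ Set.Ioo (0 : I) 1 := by
  obtain ⟨g, hg⟩ := u.toVertex.2
  have h : g • x = point u := hg
  exact h ▸ smul_mem_Ioo g hx

/-- Isomorphisms of marked Schreier graphs do not move points. -/
theorem MarkedIso.point_onVertices {x y : I} (hx : x ∈ Set.Ioo (0 : I) 1)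
    (hy : y ∈ Set.Ioo (0 : I) 1) (φ : MarkedIso x y) (u : Schreier x) :
    point (φ.onVertices u) = point u := by
  -- By equivariance and injectivity, a vertex and its image have the same stabilizer in
  -- `genClosure`.
  have key : ∀ g ∈ genClosure, g • point (φ.onVertices u) = point (φ.onVertices u) ↔
      g • point u = point u := by
    intro g hg
    rw [← point_smul, ← point_smul, point_injective.eq_iff, point_injective.eq_iff,
      ← φ.onVertices_smul hg, φ.onVertices.injective.eq_iff]
  by_contra hne
  rcases lt_or_gt_of_ne hne with h | h
  · obtain ⟨g, hg, h1, h2⟩ := exists_genClosure_fix_move (point_mem_Ioo hx u).2 h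
    exact h2 ((key g hg).mp h1)
  · obtain ⟨g, hg, h1, h2⟩ := exists_genClosure_fix_move
      (point_mem_Ioo hy (φ.onVertices u)).2 h
    exact h2 ((key g hg).mpr h1)

theorem PointedIsomorphic.eq {x y : I} (hx : x ∈ Set.Ioo (0 : I) 1) (hy : y ∈ Set.Ioo (0 : I) 1)
    (h : PointedIsomorphic x y) : x = y := by
  obtain ⟨φ, hφ⟩ := h
  have := φ.point_onVertices hx hy (base x)
  rw [hφ] at this
  exact this.symm

/-- The image of the base vertex is a vertex of the graph of `y` whose point is still `x`. -/
theorem Isomorphic.mem_orbit {x y : I} (hx : x ∈ Set.Ioo (0 : I) 1) (hy : y ∈ Set.Ioo (0 : I) 1)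
    (h : Isomorphic x y) : y ∈ MulAction.orbit F x := by
  obtain ⟨φ⟩ := h
  rw [MulAction.mem_orbit_symm, ← show point (base x) = x from rfl,
    ← φ.point_onVertices hx hy (base x)]
  exact (φ.onVertices (base x)).toVertex.2

/-- Points of one orbit have the same marked Schreier graph. -/
theorem isomorphic_of_mem_orbit {x y : I} (h : y ∈ MulAction.orbit F x) : Isomorphic x y := by
  have ho : MulAction.orbit F x = MulAction.orbit F y := (MulAction.orbit_eq_iff.mpr h).symm
  let e : Schreier x ≃ Schreier y :=
    ⟨fun u => ⟨⟨u.toVertex, ho.subset u.toVertex.2⟩⟩,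
      fun u => ⟨⟨u.toVertex, ho.superset u.toVertex.2⟩⟩, fun _ => rfl, fun _ => rfl⟩
  have he : ∀ (i : Fin 2) (u v : Schreier x), gen i • u = v ↔ gen i • e u = e v := by
    intro i u v
    rw [← e.injective.eq_iff]
    exact Iff.rfl
  exact ⟨⟨e, fun u v => Equiv.subtypeEquivRight fun i => he i u v, fun _ _ _ => rfl⟩⟩

/-! ### Orbits and tails of binary expansions -/

/-- `A` is the integer written by the first `n` digits. -/
theorem exists_two_pow_mul_ofDigits (a : ℕ → Fin 2) (n : ℕ) :
    ∃ A : ℕ, 2 ^ n * Real.ofDigits a = A + Real.ofDigits (fun k => a (n + k)) := by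
  induction n with
  | zero => exact ⟨0, by simp⟩
  | succ n ih =>
    obtain ⟨A, hA⟩ := ih
    refine ⟨2 * A + a n, ?_⟩
    have h := Real.ofDigits_eq_sum_add_ofDigits (fun k => a (n + k)) 1
    have e : (fun k => a (n + (k + 1))) = fun k => a (n + 1 + k) := by
      funext k; congr 1; ring
    simp only [Finset.range_one, Finset.sum_singleton, Real.ofDigitsTerm, e] at h
    rw [pow_succ', mul_assoc, hA, h]
    push_cast
    simp only [add_zero, pow_one]
    ring

/-- Points with the same tails of binary expansions lie in one orbit. -/
theorem SameTails.mem_orbit {x y : I} (hx : x ∈ Set.Ioo (0 : I) 1) (hy : y ∈ Set.Ioo (0 : I) 1)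
    (h : SameTails x y) : y ∈ MulAction.orbit F x := by
  obtain ⟨a, b, ha, hb, m, n, hab⟩ := h
  -- At level `l` or finer, dyadic intervals containing `x` or `y` avoid 0 and 1, as
  -- `exists_genClosure_affine` requires.
  obtain ⟨l, hl⟩ : ∃ l : ℕ, ∀ z ∈ ({x, y} : Set I), 1 < 2 ^ l * (z : ℝ) ∧
      1 < 2 ^ l * (1 - (z : ℝ)) := by
    have hx0 : (0 : ℝ) < x := hx.1
    have hx1 : (x : ℝ) < 1 := hx.2
    have hy0 : (0 : ℝ) < y := hy.1
    have hy1 : (y : ℝ) < 1 := hy.2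
    have ev : ∀ r : ℝ, 0 < r → ∀ᶠ l : ℕ in Filter.atTop, 1 < 2 ^ l * r := fun r hr =>
      ((tendsto_pow_atTop_atTop_of_one_lt (one_lt_two (α := ℝ))).atTop_mul_const
        hr).eventually_gt_atTop 1
    obtain ⟨l, h1, h2, h3, h4⟩ := ((ev x hx0).and ((ev (1 - x) (by linarith)).and
      ((ev y hy0).and (ev (1 - y) (by linarith))))).exists
    refine ⟨l, ?_⟩
    rintro z (rfl | rfl)
    exacts [⟨h1, h2⟩, ⟨h3, h4⟩]
  -- Any expansion `c` is allowed: a tail of value 0 or 1 is an endpoint of the closed interval.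
  have key : ∀ z ∈ ({x, y} : Set I), ∀ c : ℕ → Fin 2, Real.ofDigits c = z → ∀ p : ℕ, ∃ h : F,
      ((h • z : I) : ℝ) = 1 / 2 + Real.ofDigits (fun k => c (p + l + 2 + k)) / 4 := by
    intro z hz c hc p
    obtain ⟨A, hA⟩ := exists_two_pow_mul_ofDigits c (p + l + 2)
    have s0 := Real.ofDigits_nonneg (fun k => c (p + l + 2 + k))
    have s1 := Real.ofDigits_le_one (fun k => c (p + l + 2 + k))
    rw [hc] at hA
    obtain ⟨h1, h2⟩ := hl z hz
    have hp : (2 : ℝ) ^ l ≤ 2 ^ (p + l + 2) := pow_le_pow_right₀ one_le_two (by omega)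
    have hz0 : (0 : ℝ) ≤ z := z.2.1
    have hz1 : (0 : ℝ) ≤ 1 - z := by linarith [z.2.2]
    have h1' := mul_le_mul_of_nonneg_right hp hz0
    have h2' := mul_le_mul_of_nonneg_right hp hz1
    obtain ⟨h, -, H⟩ := exists_genClosure_affine (p + l) A
      (by have : (0 : ℝ) < A := by linarith
          exact_mod_cast this)
      (by have : (A : ℝ) + 1 < 2 ^ (p + l + 2) := by linarith
          exact_mod_cast this)
    exact ⟨h, H z _ ⟨s0, s1⟩ (by rw [← hA]; ring)⟩
  obtain ⟨g, hg⟩ := key x (by simp) a ha m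
  obtain ⟨h, hh⟩ := key y (by simp) b hb n
  have e : (fun k => a (m + l + 2 + k)) = fun k => b (n + l + 2 + k) := by
    funext k
    have := hab (l + 2 + k)
    simpa only [add_assoc] using this
  have hgh : g • x = h • y := Subtype.ext (by rw [hg, hh, e])
  exact ⟨h⁻¹ * g, by
    change (h⁻¹ * g) • x = y
    rw [mul_smul, hgh, inv_smul_smul]⟩

/-- Elements of `F` act by maps `t ↦ (2 ^ q * t + c) / 2 ^ p` with `c` an integer. -/
theorem exists_two_pow_mul_smul (g : F) (t : I) :
    ∃ (p q : ℕ) (c : ℤ), 2 ^ p * ((g • t : I) : ℝ) = 2 ^ q * (t : ℝ) + c := by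
  obtain ⟨hm, B, hB, hBf⟩ := g.2
  obtain ⟨b, -, hb, hfb, n, hn⟩ := exists_dyadic_below hm hB hBf _ t le_rfl
  -- The constant term of the affine piece through `t` is dyadic because `b` and its image are.
  obtain ⟨c, k, hc⟩ := hfb.sub (hb.zpow_mul n)
  have hn' : ((g • t : I) : ℝ) = 2 ^ n * t + c / 2 ^ k := by
    rw [← hc]
    change (((g : I ≃ₜ I) t : I) : ℝ) = _
    rw [hn]
    ring
  rw [hn']
  obtain ⟨l, rfl | rfl⟩ := n.eq_nat_or_neg
  · refine ⟨k, k + l, c, ?_⟩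
    rw [zpow_natCast, pow_add]
    field_simp
  · refine ⟨k + l, k, 2 ^ l * c, ?_⟩
    rw [zpow_neg, zpow_natCast, pow_add]
    push_cast
    field_simp

/-- Digits are indexed from 0, so digit `i` has weight `2 ^ (-(i + 1))`. -/
theorem coe_digits_two {x : ℝ} (hx : 0 ≤ x) (i : ℕ) :
    ((Real.digits x 2 i : ℕ) : ℤ) = ⌊2 ^ (i + 1) * x⌋ % 2 := by
  have h : (0 : ℝ) ≤ 2 ^ (i + 1) * x := by positivity
  rw [Real.digits, Fin.val_ofNat, ← Int.natCast_floor_eq_floor h, mul_comm]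
  norm_cast

/-- Points of one orbit have binary expansions with the same tails. -/
theorem sameTails_of_mem_orbit {x y : I} (hx : x ∈ Set.Ioo (0 : I) 1)
    (hy : y ∈ Set.Ioo (0 : I) 1) (h : y ∈ MulAction.orbit F x) : SameTails x y := by
  obtain ⟨g, hg⟩ := h
  have hg' : g • x = y := hg
  obtain ⟨p, q, c, hc⟩ := exists_two_pow_mul_smul g x
  rw [hg'] at hc
  refine ⟨Real.digits x 2, Real.digits y 2, Real.ofDigits_digits one_lt_two ⟨x.2.1, hx.2⟩,
    Real.ofDigits_digits one_lt_two ⟨y.2.1, hy.2⟩, q, p, fun k => ?_⟩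
  apply Fin.ext
  zify
  rw [coe_digits_two x.2.1, coe_digits_two y.2.1]
  -- The extra factor 2 makes the integer shift even for every `k`, so the parity of the floor,
  -- which is the digit, is unchanged.
  have e : (2 : ℝ) ^ (p + k + 1) * y = 2 ^ (q + k + 1) * x + (2 * (2 ^ k * c) : ℤ) := by
    push_cast
    linear_combination 2 ^ (k + 1) * hc
  rw [e, Int.floor_add_intCast, Int.add_mul_emod_self_left]

end ThompsonSchreier

end

theorem mainTheorem10 :
    (∀ x y : unitInterval, x ∈ Set.Ioo (0 : unitInterval) 1 → y ∈ Set.Ioo (0 : unitInterval) 1 →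
      x ≠ y → ¬ ThompsonSchreier.PointedIsomorphic x y) ∧
    (∀ x y : unitInterval, x ∈ Set.Ioo (0 : unitInterval) 1 → y ∈ Set.Ioo (0 : unitInterval) 1 →
      List.TFAE [ThompsonSchreier.Isomorphic x y,
        y ∈ MulAction.orbit ThompsonSchreier.F x,
        ThompsonSchreier.SameTails x y]) := by
  refine ⟨fun x y hx hy hne h => hne (h.eq hx hy), fun x y hx hy => ?_⟩
  tfae_have 1 → 2 := fun h => h.mem_orbit hx hy
  tfae_have 2 → 1 := ThompsonSchreier.isomorphic_of_mem_orbit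
  tfae_have 2 → 3 := ThompsonSchreier.sameTails_of_mem_orbit hx hy
  tfae_have 3 → 2 := fun h => h.mem_orbit hx hy
  tfae_finish
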